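/- Let $(G,<)$ be a linearly ordered abelian group. A cut in a linearly ordered set $I$ is a pair $(D,E)$ of nonempty sets with $D\cup E=I$ and $d<e$ for all $d\in D$, $e\in E$; its cofinality is the pair $(\kappa,\lambda)$, where $\kappa$ is the cofinality of $D$ and $\lambda$ is the coinitiality of $E$ (the cofinality of $E$ under the reversed ordering). The cut is asymmetric if $\kappa\neq\lambda$, and strongly asymmetric if in addition at least one of $\kappa,\lambda$ is uncountable. $I$ is symmetrically complete if every cut in $I$ is asymmetric, strongly symmetrically complete if every cut in $I$ is strongly asymmetric, and extremely symmetrically complete if it is strongly symmetrically complete and both the cofinality and the coinitiality of $I$ are uncountable. For $a\in G$ let $va$ be the archimedean class of $a$; classes are ordered by $va>vb$ iff $n|a|<|b|$ for all $n\in\mathbb N$, so that $v0$ is the largest class. Let $vG=\{vg : 0\neq g\in G\}$ be the value set. For $\gamma\in vG$ the archimedean component $\mathcal C_\gamma$ is the ordered group $\{g : vg\ge\gamma\}/\{g : vg>\gamma\}$. $G$ is spherically complete with respect to $v$ if every nonempty chain (under inclusion) of ultrametric balls $B(a,b)=\{g\in G : v(a-g)\ge v(a-b)\}$, $a,b\in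 G$, has nonempty intersection. Consider the condition (*) $G$ is spherically complete with respect to its natural valuation $v$, the value set $vG$ is strongly symmetrically complete, and every archimedean component $\mathcal C_\gamma$, $\gamma\in vG$, is isomorphic to $\mathbb R$ as an ordered group. Then: 1. $G$ is symmetrically complete if and only if (*) holds. 2. If $G\neq\{0\}$, then $G$ is strongly symmetrically complete if and only if (*) holds and the cofinality of $vG$ is uncountable. 3. $G$ is extremely symmetrically complete if and only if (*) holds and $vG$ is extremely symmetrically complete. -/

import Mathlib

open Cardinal

universe u

namespace SymmComplete

section Cuts

variable {I : Type u} [LinearOrder I]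

/-- `(D, E)` is a (Dedekind) cut of the linearly ordered set `I`: both sets are nonempty, their
union is `I`, and every element of `D` is smaller than every element of `E`. -/
structure IsCut (D E : Set I) : Prop where
  nonempty_lower : D.Nonempty
  nonempty_upper : E.Nonempty
  union_eq : D ∪ E = Set.univ
  lt : ∀ d ∈ D, ∀ e ∈ E, d < e

variable (I) in
/-- The cofinality of a linearly ordered set. -/
noncomputable def cf : Cardinal.{u} := Order.cof I

variable (I) in
/-- The coinitiality of a linearly ordered set: the cofinality under the reversed ordering. -/
noncomputable def ci : Cardinal.{u} := Order.cof Iᵒᵈ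

/-- A cut `(D, E)` of cofinality `(κ, μ)`, where `κ = cf D` and `μ = ci E`, is asymmetric if
`κ ≠ μ`. -/
def IsAsymmetric (D E : Set I) : Prop := cf D ≠ ci E

/-- A cut `(D, E)` of cofinality `(κ, μ)` is strongly asymmetric if `κ ≠ μ` and at least one of
`κ`, `μ` is uncountable. -/
def IsStronglyAsymmetric (D E : Set I) : Prop :=
  cf D ≠ ci E ∧ (ℵ₀ < cf D ∨ ℵ₀ < ci E)

variable (I) in
/-- Every cut is asymmetric. -/
def SymmetricallyComplete : Prop := ∀ D E : Set I, IsCut D E → IsAsymmetric D E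

variable (I) in
/-- Every cut is strongly asymmetric. -/
def StronglySymmetricallyComplete : Prop := ∀ D E : Set I, IsCut D E → IsStronglyAsymmetric D E

variable (I) in
/-- Every cut is strongly asymmetric, and coinitiality and cofinality of the whole set are both
uncountable. -/
def ExtremelySymmetricallyComplete : Prop :=
  StronglySymmetricallyComplete I ∧ ℵ₀ < ci I ∧ ℵ₀ < cf I

end Cuts

section Groups

variable {G : Type u} [AddCommGroup G] [LinearOrder G] [IsOrderedAddMonoid G]

/-- The natural valuation of `G`: it sends `a` to its archimedean class. Classes are ordered so that
`v a ≤ v b` iff `|b| ≤ n • |a|` for some natural number `n`; the class of `0` is the top element. -/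
def v (a : G) : ArchimedeanClass G := ArchimedeanClass.mk a

variable (G) in
/-- The value set of `G`: the archimedean classes of the nonzero elements of `G`. -/
abbrev ValueSet : Type u := FiniteArchimedeanClass G

/-- The smallest ultrametric ball containing `a` and `b`. -/
def ball (a b : G) : Set G := {g | v (a - b) ≤ v (a - g)}

variable (G) in
/-- Spherical completeness with respect to the natural valuation: every nonempty chain of
ultrametric balls has a nonempty intersection. -/
def SphericallyComplete : Prop :=
  ∀ S : Set (Set G), S.Nonempty → (∀ B ∈ S, ∃ a b : G, B = ball a b) →
    IsChain (· ⊆ ·) S → (⋂₀ S).Nonempty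

/-- `𝒪_γ`, the convex subgroup of all `g` with `v g ≥ γ`. -/
def valO (γ : ValueSet G) : AddSubgroup G where
  carrier := {g | γ.1 ≤ v g}
  zero_mem' := by simp [v]
  add_mem' {a b} ha hb := (le_min ha hb).trans (ArchimedeanClass.min_le_mk_add a b)
  neg_mem' {a} ha := by simpa [v] using ha

/-- `ℳ_γ`, the convex subgroup of all `g` with `v g > γ`. -/
def valM (γ : ValueSet G) : AddSubgroup G where
  carrier := {g | γ.1 < v g}
  zero_mem' := by simpa [v] using lt_top_iff_ne_top.2 γ.2
  add_mem' {a b} ha hb := (lt_min ha hb).trans_le (ArchimedeanClass.min_le_mk_add a b)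
  neg_mem' {a} ha := by simpa [v] using ha

/-- The archimedean component `𝒞_γ = 𝒪_γ / ℳ_γ`. -/
def Component (γ : ValueSet G) : Type u := valO γ ⧸ (valM γ).addSubgroupOf (valO γ)

namespace Component

variable {γ : ValueSet G}

instance : AddCommGroup (Component γ) :=
  inferInstanceAs (AddCommGroup (valO γ ⧸ (valM γ).addSubgroupOf (valO γ)))

/-- The residue map `𝒪_γ → 𝒞_γ`. -/
def mk : valO γ →+ Component γ := QuotientAddGroup.mk' ((valM γ).addSubgroupOf (valO γ))

theorem mk_surjective : Function.Surjective (mk (γ := γ)) :=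
  QuotientAddGroup.mk'_surjective _

theorem mk_eq_mk {a b : valO γ} : mk a = mk b ↔ (b : G) - a ∈ valM γ := by
  refine QuotientAddGroup.eq.trans ?_
  rw [AddSubgroup.mem_addSubgroupOf]
  simp [sub_eq_neg_add]

/-- The ordering induced from `𝒪_γ` on its quotient by the convex subgroup `ℳ_γ`. -/
instance : LE (Component γ) := ⟨fun x y => ∃ a b : valO γ, mk a = x ∧ mk b = y ∧ a ≤ b⟩

theorem mk_le_mk {a b : valO γ} : mk a ≤ mk b ↔ a ≤ b ∨ mk a = mk b := by
  constructor
  · rintro ⟨a', b', ha, hb, hab⟩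
    rcases le_total a b with h | h
    · exact Or.inl h
    · right
      rw [mk_eq_mk, ← neg_sub, neg_mem_iff]
      rw [mk_eq_mk] at ha hb
      have h1 : ((a : G) - a') + (b' - b) ∈ valM γ :=
        add_mem ha (by rw [← neg_sub, neg_mem_iff]; exact hb)
      have h2 : (0 : G) ≤ a - b := sub_nonneg.2 h
      have h3 : (a : G) - b ≤ (a - a') + (b' - b) := by
        have : (a' : G) ≤ b' := hab
        have h4 : (a - a') + (b' - b) = ((a : G) - b) + (b' - a') := by abel
        rw [h4]
        exact le_add_of_nonneg_right (sub_nonneg.2 this)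
      exact lt_of_lt_of_le h1 (ArchimedeanClass.mk_antitoneOn h2 (h2.trans h3) h3)
  · rintro (h | h)
    · exact ⟨a, b, rfl, rfl, h⟩
    · exact ⟨a, a, rfl, h, le_rfl⟩

noncomputable instance : LinearOrder (Component γ) where
  le_refl x := by
    obtain ⟨a, rfl⟩ := mk_surjective x
    exact mk_le_mk.2 (Or.inr rfl)
  le_trans x y z := by
    rintro ⟨a, b, rfl, rfl, hab⟩ ⟨b', c, hb, rfl, hbc⟩
    refine ⟨a, c + (b - b'), rfl, ?_, ?_⟩
    · rw [map_add, map_sub, hb, sub_self, add_zero]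
    · have : c + (b - b') = b + (c - b') := by abel
      rw [this]
      exact hab.trans (le_add_of_nonneg_right (sub_nonneg.2 hbc))
  le_antisymm x y := by
    obtain ⟨a, rfl⟩ := mk_surjective x
    obtain ⟨b, rfl⟩ := mk_surjective y
    rw [mk_le_mk, mk_le_mk]
    rintro (h | h) (h' | h')
    · rw [le_antisymm h h']
    · exact h'.symm
    · exact h
    · exact h
  le_total x y := by
    obtain ⟨a, rfl⟩ := mk_surjective x
    obtain ⟨b, rfl⟩ := mk_surjective y
    rw [mk_le_mk, mk_le_mk]
    exact (le_total a b).imp Or.inl Or.inl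
  toDecidableLE := Classical.decRel _

instance : IsOrderedAddMonoid (Component γ) where
  add_le_add_left x y := by
    rintro ⟨a, b, rfl, rfl, h⟩ z
    obtain ⟨c, rfl⟩ := mk_surjective z
    exact ⟨a + c, b + c, map_add _ _ _, map_add _ _ _, by gcongr⟩

end Component

end Groups

end SymmComplete

namespace SymmComplete

/-! ### Cofinalities of ordered sets and of the two sides of a cut -/

section Cofinality

/-! Cuts in `G` and cuts in `vG` are compared through the sets `posIn Δ`. Multiples of a positive
element are cofinal in its archimedean class, and fractions of it, when available (`Halving`), are
coinitial. Since `v` reverses order on positive elements, `cf (posIn Δ) = max (ci Δ) ℵ₀` and `ci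
(posIn Δ) = max (cf Δ) ℵ₀` (`cf_posIn`, `ci_posIn`). The `ℵ₀` is why plain asymmetry in `G`
corresponds to strong asymmetry in `vG`.

Sufficiency: every cut `(D, E)` has, up to reflection, a center `c` (`exists_center`). If the values
`v (e - d)` have a maximum `γ`, then `c` comes from a supremum in `𝒞_γ ≅ ℝ`; if not, from the
intersection of the balls `ball d e`. Seen from `c`, the set `E` is `posIn Δ` for an initial segment
`Δ` of `vG`, and the part of `D` above `c` is `posIn Δᶜ`, so the cut inherits the asymmetry of `(Δ,
Δᶜ)`. If `Δᶜ` is empty, the cofinality is `(1, max (cf vG) ℵ₀)`.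

Necessity: each failure of the criterion yields a cut with equal cofinalities. A discrete component
gives a cut with a point reflection, a dense proper subgroup of `ℝ` one of type `(ℵ₀, ℵ₀)`, and a
chain of balls with empty intersection one whose sides are both governed by the chain. A bad cut of
`vG` lifts through `posIn`.

The remaining two claims follow from the cut just above `0` and from `cf G = ci G = max (ci vG) ℵ₀`.
-/

theorem cof_le_cof_of_tendsto {α β : Type u} [LinearOrder α] [LinearOrder β] (g : α → β)
    (h : ∀ b, ∃ a₀, ∀ a, a₀ ≤ a → b ≤ g a) : Order.cof β ≤ Order.cof α := by
  obtain ⟨s, hs, hc⟩ := Order.exists_cof_eq α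
  rw [← hc]
  refine (Order.cof_le (s := g '' s) fun b => ?_).trans mk_image_le
  obtain ⟨a₀, ha₀⟩ := h b
  obtain ⟨a, ha, hle⟩ := hs a₀
  exact ⟨g a, ⟨a, ha, rfl⟩, ha₀ a hle⟩

/-- The cofinality does not change, except that finite values become `ℵ₀`, along a monotone
surjection with fibres of countable cofinality. -/
theorem cof_eq_max {α β : Type u} [LinearOrder α] [LinearOrder β] [Nonempty α] [NoMaxOrder α]
    (f : α → β) (hf : Monotone f) (hsurj : Function.Surjective f) (s : β → ℕ → α)
    (hs : ∀ a, ∃ n, a ≤ s (f a) n) : Order.cof α = max (Order.cof β) ℵ₀ := by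
  apply le_antisymm
  · obtain ⟨T, hT, hc⟩ := Order.exists_cof_eq β
    have h1 : IsCofinal (Set.range fun p : T × ℕ => s p.1 p.2) := by
      intro a
      obtain ⟨t, ht, hat⟩ := hT (f a)
      obtain ⟨a', rfl⟩ := hsurj t
      obtain ⟨n, hn⟩ := hs (max a a')
      refine ⟨_, ⟨(⟨f a', ht⟩, n), rfl⟩, (le_max_left a a').trans ?_⟩
      rw [hf.map_max, max_eq_right hat] at hn
      exact hn
    refine (Order.cof_le h1).trans (mk_range_le.trans ?_)
    rw [← hc]
    have := mul_le_max #T ℵ₀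
    simpa using this
  · refine max_le (cof_le_cof_of_tendsto f fun b => ?_) Order.aleph0_le_cof
    obtain ⟨a, rfl⟩ := hsurj b
    exact ⟨a, fun a' h => hf h⟩

variable {I J : Type u} [LinearOrder I] [LinearOrder J]

theorem ci_eq_ci_of_strictMonoOn {s : Set I} {t : Set J} (f : I → J) (hf : StrictMonoOn f s)
    (hm : Set.MapsTo f s t) (hc : ∀ y ∈ t, ∃ x ∈ s, f x ≤ y) : ci s = ci t := by
  refine Order.cof_congr_of_strictMono (α := sᵒᵈ) (γ := tᵒᵈ)
    (f := fun x => OrderDual.toDual ⟨f (OrderDual.ofDual x).1, hm (OrderDual.ofDual x).2⟩)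
    (fun x y h => hf (OrderDual.ofDual y).2 (OrderDual.ofDual x).2 h) ?_
  intro y
  obtain ⟨x, hx, hxy⟩ := hc (OrderDual.ofDual y).1 (OrderDual.ofDual y).2
  exact ⟨_, ⟨OrderDual.toDual ⟨x, hx⟩, rfl⟩, hxy⟩

theorem cf_eq_cf_of_strictMonoOn {s : Set I} {t : Set J} (f : I → J) (hf : StrictMonoOn f s)
    (hm : Set.MapsTo f s t) (hc : ∀ y ∈ t, ∃ x ∈ s, y ≤ f x) : cf s = cf t := by
  refine Order.cof_congr_of_strictMono (α := s) (γ := t)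
    (f := fun x => ⟨f x.1, hm x.2⟩) (fun x y h => hf x.2 y.2 h) ?_
  intro y
  obtain ⟨x, hx, hxy⟩ := hc y.1 y.2
  exact ⟨_, ⟨⟨x, hx⟩, rfl⟩, hxy⟩

theorem cf_eq_ci_of_strictAntiOn {s : Set I} {t : Set J} (f : I → J) (hf : StrictAntiOn f s)
    (hm : Set.MapsTo f s t) (hc : ∀ y ∈ t, ∃ x ∈ s, f x ≤ y) : cf s = ci t := by
  refine Order.cof_congr_of_strictMono (α := s) (γ := tᵒᵈ)
    (f := fun x => OrderDual.toDual ⟨f x.1, hm x.2⟩)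
    (fun x y h => hf x.2 y.2 h) ?_
  intro y
  obtain ⟨x, hx, hxy⟩ := hc (OrderDual.ofDual y).1 (OrderDual.ofDual y).2
  exact ⟨_, ⟨⟨x, hx⟩, rfl⟩, hxy⟩

theorem ci_le_cf_of_tendsto {s : Set I} {t : Set J} (g : s → t)
    (h : ∀ y : t, ∃ x₀ : s, ∀ x : s, x₀ ≤ x → g x ≤ y) : ci t ≤ cf s :=
  cof_le_cof_of_tendsto (α := s) (β := tᵒᵈ) (fun x => OrderDual.toDual (g x)) fun y =>
    h (OrderDual.ofDual y)

theorem cf_le_ci_of_tendsto {s : Set I} {t : Set J} (g : s → t)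
    (h : ∀ y : t, ∃ x₀ : s, ∀ x : s, x ≤ x₀ → y ≤ g x) : cf t ≤ ci s :=
  cof_le_cof_of_tendsto (α := sᵒᵈ) (β := t) (fun x => g (OrderDual.ofDual x)) fun y =>
    (h y).imp fun _ hx x hle => hx (OrderDual.ofDual x) hle

theorem cf_eq_one {s : Set I} {a : I} (ha : a ∈ s) (h : ∀ x ∈ s, x ≤ a) : cf s = 1 :=
  Order.cof_eq_one_iff.2 ⟨⟨a, ha⟩, fun x => h x.1 x.2⟩

theorem cf_eq_aleph0 {s : Set I} (hne : s.Nonempty) (hmax : ∀ x ∈ s, ∃ y ∈ s, x < y) (z : ℕ → I)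
    (hz : ∀ n, z n ∈ s) (hc : ∀ x ∈ s, ∃ n, x ≤ z n) : cf s = ℵ₀ := by
  have : Nonempty s := hne.to_subtype
  have : NoMaxOrder s := ⟨fun x => by
    obtain ⟨y, hy, h⟩ := hmax x.1 x.2
    exact ⟨⟨y, hy⟩, h⟩⟩
  refine le_antisymm ?_ Order.aleph0_le_cof
  refine (Order.cof_le (s := Set.range fun n => (⟨z n, hz n⟩ : s)) fun x => ?_).trans
    (Set.countable_range _).le_aleph0
  obtain ⟨n, hn⟩ := hc x.1 x.2
  exact ⟨_, ⟨n, rfl⟩, hn⟩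

/-- Lifting a cut from `vG` to `G` raises both cofinalities to at least `ℵ₀`; strong asymmetry is
exactly what survives this. -/
theorem stronglyAsymmetric_iff_max {κ μ : Cardinal.{u}} :
    (κ ≠ μ ∧ (ℵ₀ < κ ∨ ℵ₀ < μ)) ↔ max κ ℵ₀ ≠ max μ ℵ₀ := by
  constructor
  · rintro ⟨hne, h | h⟩ heq
    · rw [max_eq_left h.le] at heq
      rcases max_choice μ ℵ₀ with h' | h' <;> rw [h'] at heq
      · exact hne heq
      · exact h.ne' heq
    · rw [max_eq_left h.le] at heq
      rcases max_choice κ ℵ₀ with h' | h' <;> rw [h'] at heq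
      · exact hne heq
      · exact h.ne heq
  · intro hne
    refine ⟨fun h => hne (by rw [h]), ?_⟩
    by_contra! h
    exact hne (by rw [max_eq_right h.1, max_eq_right h.2])

theorem IsCut.mem_or_mem {D E : Set I} (h : IsCut D E) (x : I) : x ∈ D ∨ x ∈ E := by
  have : x ∈ D ∪ E := h.union_eq ▸ Set.mem_univ x
  exact this

theorem IsCut.mem_upper_of_le {D E : Set I} (h : IsCut D E) {x y : I} (hx : x ∈ E) (hxy : x ≤ y) :
    y ∈ E :=
  (h.mem_or_mem y).resolve_left fun hy => (h.lt y hy x hx).not_ge hxy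

end Cofinality

/-! ### The natural valuation and the cofinalities of `posIn Δ` -/

section Valuation

variable {G : Type u} [AddCommGroup G] [LinearOrder G] [IsOrderedAddMonoid G]

theorem v_neg (a : G) : v (-a) = v a := ArchimedeanClass.mk_neg a

theorem v_sub_comm (a b : G) : v (a - b) = v (b - a) := ArchimedeanClass.mk_sub_comm a b

theorem v_eq_top {a : G} : v a = ⊤ ↔ a = 0 := ArchimedeanClass.mk_eq_top_iff

theorem min_le_v_add (a b : G) : min (v a) (v b) ≤ v (a + b) := ArchimedeanClass.min_le_mk_add a b

theorem min_le_v_sub (a b : G) : min (v a) (v b) ≤ v (a - b) := ArchimedeanClass.min_le_mk_sub a b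

theorem v_le_of_le {a b : G} (ha : 0 ≤ a) (hab : a ≤ b) : v b ≤ v a :=
  ArchimedeanClass.mk_antitoneOn ha (ha.trans hab) hab

theorem lt_of_v_lt {a b : G} (ha : 0 ≤ a) (h : v a < v b) : b < a :=
  ArchimedeanClass.lt_of_mk_lt_mk_of_nonneg h ha

theorem v_le_iff {a b : G} (ha : 0 ≤ a) (hb : 0 ≤ b) : v a ≤ v b ↔ ∃ n : ℕ, b ≤ n • a := by
  refine ArchimedeanClass.mk_le_mk.trans ?_
  rw [abs_of_nonneg ha, abs_of_nonneg hb]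

theorem v_nsmul {a : G} (ha : 0 ≤ a) {n : ℕ} (hn : n ≠ 0) : v (n • a) = v a := by
  apply le_antisymm
  · exact v_le_of_le ha (by simpa using nsmul_le_nsmul_left ha (Nat.one_le_iff_ne_zero.2 hn))
  · exact (v_le_iff ha (nsmul_nonneg ha n)).2 ⟨n, le_rfl⟩

theorem exists_pos_v_eq (γ : ValueSet G) : ∃ g : G, 0 < g ∧ v g = γ.1 := by
  obtain ⟨γ, hγ⟩ := γ
  obtain ⟨g, rfl⟩ := ArchimedeanClass.mk_surjective (M := G) γ
  exact ⟨|g|, abs_pos.2 fun h => hγ (v_eq_top.2 h), ArchimedeanClass.mk_abs g⟩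

/-- The positive elements with value in `Δ`. -/
def posIn (Δ : Set (ValueSet G)) : Set G := {x | 0 < x ∧ ∃ δ ∈ Δ, v x = δ.1}

theorem mem_posIn_of_v_eq {Δ : Set (ValueSet G)} {x y : G} (hx : x ∈ posIn Δ) (hy : 0 < y)
    (h : v y = v x) : y ∈ posIn Δ := by
  obtain ⟨-, δ, hδ, hxδ⟩ := hx
  exact ⟨hy, δ, hδ, h.trans hxδ⟩

theorem exists_mem_posIn {Δ : Set (ValueSet G)} {δ : ValueSet G} (hδ : δ ∈ Δ) :
    ∃ x ∈ posIn Δ, v x = δ.1 := by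
  obtain ⟨g, hg, hv⟩ := exists_pos_v_eq δ
  exact ⟨g, ⟨hg, δ, hδ, hv⟩, hv⟩

/-- The value of an element of `posIn Δ`. -/
noncomputable def posIn.val {Δ : Set (ValueSet G)} (x : posIn Δ) : Δ :=
  ⟨⟨v x.1, fun h => x.2.1.ne' (v_eq_top.1 h)⟩, by
    obtain ⟨δ, hδ, h⟩ := x.2.2
    convert! hδ⟩

theorem posIn.val_val {Δ : Set (ValueSet G)} (x : posIn Δ) : (posIn.val x).1.1 = v x.1 := rfl

theorem posIn.val_anti {Δ : Set (ValueSet G)} {x y : posIn Δ} (h : x ≤ y) :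
    posIn.val y ≤ posIn.val x :=
  v_le_of_le x.2.1.le h

theorem posIn.val_surjective {Δ : Set (ValueSet G)} :
    Function.Surjective (posIn.val (Δ := Δ)) := fun δ => by
  obtain ⟨x, hx, h⟩ := exists_mem_posIn δ.2
  exact ⟨⟨x, hx⟩, Subtype.ext (Subtype.ext h)⟩

/-- Each fibre of the order-reversing value map has the multiples of one element as a countable
cofinal set. -/
theorem cf_posIn {Δ : Set (ValueSet G)} (hne : Δ.Nonempty) : cf (posIn Δ) = max (ci Δ) ℵ₀ := by
  obtain ⟨δ₀, hδ₀⟩ := hne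
  obtain ⟨x₀, hx₀, -⟩ := exists_mem_posIn hδ₀
  have : Nonempty (posIn Δ) := ⟨⟨x₀, hx₀⟩⟩
  have hsmul : ∀ (x : posIn Δ) (n : ℕ), (n + 1) • x.1 ∈ posIn Δ := fun x n =>
    mem_posIn_of_v_eq x.2 (nsmul_pos x.2.1 n.succ_ne_zero) (v_nsmul x.2.1.le n.succ_ne_zero)
  have : NoMaxOrder (posIn Δ) := ⟨fun x => ⟨⟨_, hsmul x 1⟩, by
    change x.1 < (1 + 1) • x.1
    rw [add_smul, one_smul]
    exact lt_add_of_pos_right _ x.2.1⟩⟩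
  choose g hg using posIn.val_surjective (Δ := Δ)
  refine cof_eq_max (β := Δᵒᵈ) (fun x => OrderDual.toDual (posIn.val x))
    (fun x y h => posIn.val_anti h) (fun δ => posIn.val_surjective (OrderDual.ofDual δ))
    (fun δ n => ⟨_, hsmul (g (OrderDual.ofDual δ)) n⟩) fun x => ?_
  obtain ⟨n, hn⟩ := (v_le_iff (g (posIn.val x)).2.1.le x.2.1.le).1
    (le_of_eq (by rw [← posIn.val_val, hg, posIn.val_val]))
  refine ⟨n, hn.trans ?_⟩
  exact nsmul_le_nsmul_left (g (posIn.val x)).2.1.le n.le_succ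

variable (G) in
/-- Below every positive element there is, up to a factor `2`, one of the same value. -/
def Halving : Prop := ∀ x : G, 0 < x → ∃ y : G, 0 < y ∧ v y = v x ∧ y + y ≤ x

theorem Halving.exists_nsmul_le (hG : Halving G) {x : G} (hx : 0 < x) (n : ℕ) :
    ∃ y : G, 0 < y ∧ v y = v x ∧ (n + 1) • y ≤ x := by
  have key : ∃ y : G, 0 < y ∧ v y = v x ∧ 2 ^ n • y ≤ x := by
    induction n with
    | zero => exact ⟨x, hx, rfl, by simp⟩
    | succ n ih =>
      obtain ⟨y, hy, hv, hle⟩ := ih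
      obtain ⟨z, hz, hvz, hzy⟩ := hG y hy
      refine ⟨z, hz, hvz.trans hv, le_trans ?_ hle⟩
      rw [pow_succ, mul_smul, two_smul]
      exact nsmul_le_nsmul_right hzy _
  obtain ⟨y, hy, hv, hle⟩ := key
  exact ⟨y, hy, hv, (nsmul_le_nsmul_left hy.le Nat.lt_two_pow_self).trans hle⟩

/-- Dual to `cf_posIn`, with fractions in place of multiples. `Halving` supplies them; without it a
class could have a least positive element. -/
theorem ci_posIn (hG : Halving G) {Δ : Set (ValueSet G)} (hne : Δ.Nonempty) :
    ci (posIn Δ) = max (cf Δ) ℵ₀ := by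
  obtain ⟨δ₀, hδ₀⟩ := hne
  obtain ⟨x₀, hx₀, -⟩ := exists_mem_posIn hδ₀
  have : Nonempty (posIn Δ)ᵒᵈ := ⟨OrderDual.toDual ⟨x₀, hx₀⟩⟩
  have : NoMinOrder (posIn Δ) := ⟨fun x => by
    obtain ⟨y, hy, hv, hyx⟩ := hG x.1 x.2.1
    exact ⟨⟨y, mem_posIn_of_v_eq x.2 hy hv⟩, (lt_add_of_pos_right y hy).trans_le hyx⟩⟩
  choose g hg using posIn.val_surjective (Δ := Δ)
  have hdiv : ∀ (δ : Δ) (n : ℕ), ∃ y : posIn Δ, v y.1 = δ.1.1 ∧ (n + 1) • y.1 ≤ (g δ).1 := by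
    intro δ n
    obtain ⟨y, hy, hv, hle⟩ := hG.exists_nsmul_le (g δ).2.1 n
    exact ⟨⟨y, mem_posIn_of_v_eq (g δ).2 hy hv⟩, by rw [hv, ← posIn.val_val, hg], hle⟩
  choose s hsv hs using hdiv
  refine cof_eq_max (α := (posIn Δ)ᵒᵈ) (fun x => posIn.val (OrderDual.ofDual x))
    (fun x y h => posIn.val_anti h) posIn.val_surjective
    (fun δ n => OrderDual.toDual (s δ n)) fun x => ?_
  set x' : posIn Δ := OrderDual.ofDual x
  obtain ⟨n, hn⟩ := (v_le_iff x'.2.1.le (g (posIn.val x')).2.1.le).1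
    (le_of_eq (by rw [← posIn.val_val, ← posIn.val_val, hg]))
  refine ⟨n, ?_⟩
  change (s (posIn.val x') n).1 ≤ x'.1
  by_contra! hlt
  have h1 := (hs (posIn.val x') n).trans (hn.trans (nsmul_le_nsmul_left x'.2.1.le n.le_succ))
  exact h1.not_gt (nsmul_right_strictMono n.succ_ne_zero hlt)

end Valuation

end SymmComplete

namespace SymmComplete

variable {G : Type u} [AddCommGroup G] [LinearOrder G] [IsOrderedAddMonoid G]

/-! ### Archimedean components and residue maps to `ℝ` -/

section Residue

/-- `φ` is a residue map `𝒪_γ → ℝ`: monotone with kernel `ℳ_γ`. -/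
structure IsResidue (γ : ValueSet G) (φ : valO γ →+ ℝ) : Prop where
  mono : Monotone φ
  eq_zero_iff : ∀ a, φ a = 0 ↔ γ.1 < v (a : G)

variable {γ : ValueSet G}

theorem Component.mk_eq_zero {a : valO γ} : mk a = 0 ↔ γ.1 < v (a : G) := by
  rw [← map_zero mk, mk_eq_mk]
  rw [← neg_mem_iff, neg_sub]
  change γ.1 < v ((a : G) - (0 : G)) ↔ _
  rw [sub_zero]

theorem isResidue_comp_mk (f : Component γ →+ ℝ) (hf : Monotone f) (hinj : Function.Injective f) :
    IsResidue γ (f.comp Component.mk) where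
  mono a b h := hf (Component.mk_le_mk.2 (Or.inl h))
  eq_zero_iff a := by
    rw [AddMonoidHom.comp_apply, map_eq_zero_iff f hinj, Component.mk_eq_zero]

instance : Archimedean (Component γ) where
  arch x y hy := by
    obtain ⟨a, rfl⟩ := Component.mk_surjective x
    obtain ⟨b, rfl⟩ := Component.mk_surjective y
    rw [← map_zero Component.mk, ← not_le, Component.mk_le_mk, not_or, not_le, map_zero,
      Component.mk_eq_zero, not_lt] at hy
    rcases le_total a 0 with ha | ha
    · exact ⟨0, by
        rw [zero_smul, ← map_zero Component.mk]
        exact Component.mk_le_mk.2 (Or.inl ha)⟩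
    · have hb : (0 : G) ≤ b := hy.1.le
      obtain ⟨n, hn⟩ := (v_le_iff hb ha).1 (hy.2.trans a.2)
      refine ⟨n, ?_⟩
      rw [← map_nsmul]
      exact Component.mk_le_mk.2 (Or.inl hn)

-- Hölder's theorem for archimedean ordered groups.
variable (γ) in
theorem exists_component_embedding :
    ∃ f : Component γ →+ ℝ, Monotone f ∧ Function.Injective f := by
  obtain ⟨f, hf⟩ := Archimedean.exists_orderAddMonoidHom_real_injective (Component γ)
  exact ⟨f, f.monotone', hf⟩

theorem exists_surjective_residue (h : Nonempty (Component γ ≃+o ℝ)) :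
    ∃ φ, IsResidue γ φ ∧ Function.Surjective φ := by
  obtain ⟨e⟩ := h
  exact ⟨_, isResidue_comp_mk (e : Component γ →+ ℝ) (OrderHomClass.mono e) e.injective,
    e.surjective.comp Component.mk_surjective⟩

theorem component_iso_of_surjective
    (h : ∀ φ, IsResidue γ φ → Function.Surjective φ) : Nonempty (Component γ ≃+o ℝ) := by
  obtain ⟨f, hf, hinj⟩ := exists_component_embedding γ
  have hs : Function.Surjective f := fun r => by
    obtain ⟨a, ha⟩ := h _ (isResidue_comp_mk f hf hinj) r
    exact ⟨_, ha⟩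
  exact ⟨{ AddEquiv.ofBijective f ⟨hinj, hs⟩ with
    map_le_map_iff' := fun {a b} => (hf.strictMono_of_injective hinj).le_iff_le }⟩

variable {φ : valO γ →+ ℝ}

theorem IsResidue.lt_of_lt (hφ : IsResidue γ φ) {a b : valO γ} (h : φ a < φ b) : a < b :=
  lt_of_not_ge fun hba => (hφ.mono hba).not_gt h

theorem IsResidue.v_eq_iff (hφ : IsResidue γ φ) {a : valO γ} : v (a : G) = γ.1 ↔ φ a ≠ 0 := by
  rw [Ne, hφ.eq_zero_iff, not_lt]
  exact ⟨fun h => h.le, fun h => le_antisymm h a.2⟩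

theorem IsResidue.pos (hφ : IsResidue γ φ) {a : valO γ} (h : 0 < (a : G)) (hv : v (a : G) = γ.1) :
    0 < φ a := by
  have h0 : φ 0 ≤ φ a := hφ.mono h.le
  rw [map_zero] at h0
  exact lt_of_le_of_ne h0 (hφ.v_eq_iff.1 hv).symm

theorem halving_of_residues
    (h : ∀ γ : ValueSet G, ∃ φ, IsResidue γ φ ∧ Function.Surjective φ) : Halving G := by
  intro x hx
  have hne : v x ≠ ⊤ := fun h => hx.ne' (v_eq_top.1 h)
  obtain ⟨φ, hφ, hs⟩ := h ⟨v x, hne⟩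
  set a : valO ⟨v x, hne⟩ := ⟨x, le_refl (v x)⟩
  have ha : 0 < φ a := hφ.pos hx rfl
  -- A third rather than a half: only strict inequalities between residues lift to `𝒪_γ`.
  obtain ⟨y, hy⟩ := hs (φ a / 3)
  refine ⟨y, ?_, hφ.v_eq_iff.2 (by rw [hy]; positivity), ?_⟩
  · exact hφ.lt_of_lt (a := 0) (b := y) (by rw [map_zero, hy]; positivity)
  · exact (hφ.lt_of_lt (a := y + y) (b := a) (by rw [map_add, hy]; linarith)).le

end Residue

/-! ### Centers of cuts: sufficiency of the criterion -/

section Center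

variable {D E : Set G}

theorem IsCut.neg (h : IsCut D E) : IsCut (Neg.neg ⁻¹' E) (Neg.neg ⁻¹' D) where
  nonempty_lower := by
    obtain ⟨e, he⟩ := h.nonempty_upper
    exact ⟨-e, by simpa using he⟩
  nonempty_upper := by
    obtain ⟨d, hd⟩ := h.nonempty_lower
    exact ⟨-d, by simpa using hd⟩
  union_eq := by
    rw [Set.union_comm, ← Set.preimage_union, h.union_eq, Set.preimage_univ]
  lt x hx y hy := neg_lt_neg_iff.1 (h.lt _ hy _ hx)

theorem cf_preimage_neg (E : Set G) : cf (Neg.neg ⁻¹' E : Set G) = ci E :=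
  cf_eq_ci_of_strictAntiOn (s := Neg.neg ⁻¹' E) (t := E) Neg.neg
    (fun _ _ _ _ h => neg_lt_neg h) (fun _ h => h)
    fun y hy => ⟨-y, by simpa using hy, by simp⟩

theorem ci_preimage_neg (E : Set G) : ci (Neg.neg ⁻¹' E : Set G) = cf E := by
  refine (cf_eq_ci_of_strictAntiOn (s := E) (t := Neg.neg ⁻¹' E) Neg.neg
    (fun _ _ _ _ h => neg_lt_neg h) (fun x hx => ?_)
    fun y hy => ⟨-y, hy, by simp⟩).symm
  rwa [Set.mem_preimage, neg_neg]

/-- `c ∈ D` is a center of the cut `(D, E)`: the elements of `D` above `c` are closer to `c` than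
those of `E`. -/
structure IsCenter (D E : Set G) (c : G) : Prop where
  mem : c ∈ D
  lt : ∀ d ∈ D, c ≤ d → ∀ e ∈ E, v (e - c) < v (d - c)

/-- Translation by `c` identifies `E` with `posIn Δ`, and `posIn Δᶜ` with a cofinal subset of `D`
unless `Δᶜ` is empty. -/
theorem asymmetric_of_isCenter (hG : Halving G) (hV : StronglySymmetricallyComplete (ValueSet G))
    (h : IsCut D E) {c : G} (hc : IsCenter D E c) :
    IsAsymmetric D E ∧ (ℵ₀ < cf (ValueSet G) → IsStronglyAsymmetric D E) := by
  set Δ : Set (ValueSet G) := {δ | ∃ e ∈ E, v (e - c) = δ.1}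
  have hpos : ∀ e ∈ E, 0 < e - c := fun e he => sub_pos.2 (h.lt c hc.mem e he)
  have hne : Δ.Nonempty := by
    obtain ⟨e, he⟩ := h.nonempty_upper
    exact ⟨⟨v (e - c), fun h0 => (hpos e he).ne' (v_eq_top.1 h0)⟩, e, he, rfl⟩
  have hE : ci E = max (cf Δ) ℵ₀ := by
    rw [← ci_posIn hG hne]
    refine (ci_eq_ci_of_strictMonoOn (fun x => c + x) (fun x _ y _ hxy => by dsimp only; gcongr) ?_ ?_).symm
    · rintro x ⟨hx, δ, ⟨e, he, hδ⟩, hxδ⟩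
      refine (h.mem_or_mem _).resolve_left fun hD => ?_
      have := hc.lt _ hD (le_add_of_nonneg_right hx.le) e he
      rw [add_sub_cancel_left, hδ, hxδ] at this
      exact lt_irrefl _ this
    · intro e he
      refine ⟨e - c, ⟨hpos e he, ⟨v (e - c), fun h0 => (hpos e he).ne' (v_eq_top.1 h0)⟩,
        ⟨e, he, rfl⟩, rfl⟩, by simp⟩
  -- If `Δ` is all of `vG`, then `c` is the maximum of `D`. Only this case uses that `cf vG` is
  -- uncountable.
  rcases Δᶜ.eq_empty_or_nonempty with hΔc | hΔc
  · have hD : cf D = 1 := by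
      refine cf_eq_one hc.mem fun d hd => ?_
      by_contra! hlt
      have hd0 : v (d - c) ≠ ⊤ := fun h0 => (sub_pos.2 hlt).ne' (v_eq_top.1 h0)
      have : (⟨v (d - c), hd0⟩ : ValueSet G) ∈ Δ := by
        by_contra hn
        have : (⟨v (d - c), hd0⟩ : ValueSet G) ∈ Δᶜ := hn
        simp [hΔc] at this
      obtain ⟨e, he, hve⟩ := this
      exact (hc.lt d hd hlt.le e he).ne hve
    have has : IsAsymmetric D E := by
      rw [IsAsymmetric, hD, hE]
      exact (one_lt_aleph0.trans_le (le_max_right _ _)).ne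
    refine ⟨has, fun hcf => ⟨has, Or.inr ?_⟩⟩
    rw [Set.compl_empty_iff] at hΔc
    rw [hE, hΔc]
    exact lt_max_of_lt_left (hcf.trans_eq OrderIso.Set.univ.cof_congr.symm)
  · have hD : cf D = max (ci (Δᶜ : Set (ValueSet G))) ℵ₀ := by
      rw [← cf_posIn hΔc]
      have hmem : ∀ x ∈ posIn Δᶜ, c + x ∈ D := by
        rintro x ⟨hx, δ, hδ, hxδ⟩
        refine (h.mem_or_mem _).resolve_right fun hE => hδ ⟨_, hE, ?_⟩
        rw [add_sub_cancel_left, hxδ]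
      refine (cf_eq_cf_of_strictMonoOn (fun x => c + x) (fun x _ y _ hxy => by dsimp only; gcongr)
        hmem fun d hd => ?_).symm
      rcases le_or_gt d c with hdc | hdc
      · obtain ⟨δ, hδ⟩ := hΔc
        obtain ⟨x, hx, -⟩ := exists_mem_posIn hδ
        exact ⟨x, hx, hdc.trans (le_add_of_nonneg_right hx.1.le)⟩
      · refine ⟨d - c, ⟨sub_pos.2 hdc, ⟨v (d - c), fun h0 =>
          (sub_pos.2 hdc).ne' (v_eq_top.1 h0)⟩, ?_, rfl⟩, by simp⟩
        rintro ⟨e, he, hve⟩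
        exact (hc.lt d hd hdc.le e he).ne hve
    have hcut : IsCut Δ Δᶜ := by
      refine ⟨hne, hΔc, Set.union_compl_self _, fun δ hδ ε hε => ?_⟩
      by_contra! hle
      apply hε
      rcases hle.eq_or_lt with rfl | hlt
      · exact hδ
      obtain ⟨e, he, hve⟩ := hδ
      obtain ⟨g, hg, hvg⟩ := exists_pos_v_eq ε
      have : e - c < g := lt_of_v_lt hg.le (by rw [hvg, hve]; exact hlt)
      refine ⟨c + g, h.mem_upper_of_le he (sub_le_iff_le_add'.1 this.le), ?_⟩
      rw [add_sub_cancel_left, hvg]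
    have hs : IsStronglyAsymmetric D E := by
      have h1 := stronglyAsymmetric_iff_max.1 (hV _ _ hcut)
      rw [← hD, ← hE] at h1
      refine ⟨h1.symm, ?_⟩
      rw [hD, hE]
      simp only [lt_max_iff, lt_irrefl, or_false]
      exact (hV _ _ hcut).2.symm
    exact ⟨hs.1, fun _ => hs⟩

theorem v_sub_antitone_of_cut (h : IsCut D E) {d d' e e' : G} (hd : d' ∈ D) (he : e' ∈ E)
    (hdd : d ≤ d') (hee : e' ≤ e) : v (e - d) ≤ v (e' - d') :=
  v_le_of_le (sub_nonneg.2 (h.lt _ hd _ he).le) (by gcongr)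

/-- A cut whose distances attain a largest value is centered if the residue map at that value is
onto `ℝ`. -/
theorem exists_center_of_max (h : IsCut D E) {γ : ValueSet G} {φ : valO γ →+ ℝ}
    (hφ : IsResidue γ φ) (hs : Function.Surjective φ) {d₀ e₀ : G} (hd₀ : d₀ ∈ D) (he₀ : e₀ ∈ E)
    (hγ : v (e₀ - d₀) = γ.1) (hmax : ∀ d ∈ D, ∀ e ∈ E, v (e - d) ≤ γ.1) :
    ∃ c, IsCenter D E c ∨ IsCenter (Neg.neg ⁻¹' E) (Neg.neg ⁻¹' D) c := by
  -- `T` collects the residues of `D` relative to `d₀`. A lift `y` of its supremum gives the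
  -- candidate center `d₀ + y`, a center of the cut or of its reflection according to the side it
  -- lies on.
  set T : Set ℝ := {t | ∃ y : valO γ, d₀ + y ∈ D ∧ φ y = t}
  have hT : T.Nonempty := ⟨0, 0, by simpa using hd₀, map_zero φ⟩
  have hle : ∀ t ∈ T, ∀ z : valO γ, d₀ + z ∈ E → t ≤ φ z := by
    rintro _ ⟨y, hy, rfl⟩ z hz
    refine hφ.mono ?_
    have := h.lt _ hy _ hz
    exact (lt_of_add_lt_add_left this).le
  have hb : BddAbove T := ⟨φ ⟨e₀ - d₀, hγ.ge⟩, fun t ht => hle t ht _ (by simpa using he₀)⟩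
  obtain ⟨y, hy⟩ := hs (sSup T)
  have hmemO : ∀ x z : G, d₀ ≤ z → x ≤ z → d₀ ≤ x ∨ d₀ + y ≤ x → γ.1 ≤ v (z - d₀) →
      γ.1 ≤ v (x - d₀) := by
    rintro x z hz hxz hx hv
    rcases hx with hx | hx
    · exact hv.trans (v_le_of_le (sub_nonneg.2 hx) (by gcongr))
    · refine (le_min y.2 hv).trans (ArchimedeanClass.min_le_mk_of_le_of_le ?_ (by gcongr))
      exact le_sub_iff_add_le'.2 hx
  have hv₀ : ∀ d ∈ D, ∀ x, x ≤ d → d₀ + y ≤ x → γ.1 ≤ v (x - d₀) := fun d hd x hxd hx =>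
    hmemO x (max e₀ d) (le_max_of_le_left (h.lt _ hd₀ _ he₀).le) (le_max_of_le_right hxd)
      (Or.inr hx) (by rw [max_eq_left (h.lt _ hd _ he₀).le, hγ])
  rcases h.mem_or_mem (d₀ + y) with hc | hc
  · refine ⟨d₀ + y, Or.inl ⟨hc, fun d hd hcd e he => (hmax _ hc e he).trans_lt ?_⟩⟩
    set z : valO γ := ⟨d - d₀, hv₀ d hd d le_rfl hcd⟩ with hz
    have h1 : φ z ≤ sSup T := le_csSup hb ⟨z, by simpa [hz] using hd, rfl⟩
    have h2 : φ y ≤ φ z := hφ.mono (le_sub_iff_add_le'.2 hcd)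
    -- Points of `D` above `d₀ + y` have the same residue as `y`, hence differ from it by an element
    -- of `ℳ_γ`, whereas distances to `E` have value at most `γ`.
    have h3 : φ (z - y) = 0 := by
      rw [map_sub, hy, sub_eq_zero]
      exact le_antisymm h1 (hy ▸ h2)
    have := (hφ.eq_zero_iff _).1 h3
    rwa [AddSubgroup.coe_sub, hz, sub_sub] at this
  · refine ⟨-(d₀ + y), Or.inr ⟨by simpa using hc, fun e' he' hce' d' hd' => ?_⟩⟩
    obtain ⟨e, rfl⟩ : ∃ e, e' = -e := ⟨-e', (neg_neg _).symm⟩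
    obtain ⟨d, rfl⟩ : ∃ d, d' = -d := ⟨-d', (neg_neg _).symm⟩
    have he : e ∈ E := by simpa using he'
    have hd : d ∈ D := by simpa using hd'
    have hec : e ≤ d₀ + y := neg_le_neg_iff.1 hce'
    rw [show -d - -(d₀ + (y : G)) = d₀ + y - d by abel,
      show -e - -(d₀ + (y : G)) = d₀ + y - e by abel]
    refine (hmax d hd _ hc).trans_lt ?_
    have hed : d₀ ≤ e := (h.lt _ hd₀ _ he).le
    set z : valO γ := ⟨e - d₀, hmemO e (d₀ + y) (hed.trans hec) hec (Or.inl hed)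
      (by rw [add_sub_cancel_left]; exact y.2)⟩ with hz
    have h1 : sSup T ≤ φ z := csSup_le hT fun t ht => hle t ht z (by simpa [hz] using he)
    have h2 : φ z ≤ φ y := hφ.mono (sub_le_iff_le_add'.2 hec)
    have h3 : φ (y - z) = 0 := by
      rw [map_sub, hy, sub_eq_zero]
      exact le_antisymm h1 (hy ▸ h2)
    have := (hφ.eq_zero_iff _).1 h3
    rwa [AddSubgroup.coe_sub, hz, show (y : G) - (e - d₀) = d₀ + y - e by abel] at this

theorem mem_ball {a b x : G} : x ∈ ball a b ↔ v (a - b) ≤ v (a - x) := Iff.rfl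

theorem ball_subset_ball {a b a' b' x : G} (hx : x ∈ ball a b) (hx' : x ∈ ball a' b')
    (hv : v (a' - b') ≤ v (a - b)) : ball a b ⊆ ball a' b' := by
  intro z hz
  rw [mem_ball] at *
  have h1 : a' - z = (a' - x) + ((a - z) - (a - x)) := by abel
  rw [h1]
  exact (le_min hx' (hv.trans ((le_min hz hx).trans (min_le_v_sub _ _)))).trans (min_le_v_add _ _)

theorem mem_ball_of_le {a b x : G} (h1 : a ≤ x) (h2 : x ≤ b) : x ∈ ball a b := by
  rw [mem_ball, v_sub_comm a b, v_sub_comm a x]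
  exact v_le_of_le (sub_nonneg.2 h1) (by gcongr)

/-- A cut whose distances do not attain a largest value is centered if `G` is spherically
complete. -/
theorem exists_center_of_noMax (hS : SphericallyComplete G) (h : IsCut D E)
    (hmax : ∀ d ∈ D, ∀ e ∈ E, ∃ d' ∈ D, ∃ e' ∈ E, v (e - d) < v (e' - d')) :
    ∃ c, IsCenter D E c ∨ IsCenter (Neg.neg ⁻¹' E) (Neg.neg ⁻¹' D) c := by
  set S : Set (Set G) := {B | ∃ d ∈ D, ∃ e ∈ E, B = ball d e}
  obtain ⟨d₀, hd₀⟩ := h.nonempty_lower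
  obtain ⟨e₀, he₀⟩ := h.nonempty_upper
  obtain ⟨c, hc⟩ : (⋂₀ S).Nonempty := by
    refine hS S ⟨_, d₀, hd₀, e₀, he₀, rfl⟩ ?_ ?_
    · rintro _ ⟨d, -, e, -, rfl⟩
      exact ⟨d, e, rfl⟩
    · rintro _ ⟨d, hd, e, he, rfl⟩ _ ⟨d', hd', e', he', rfl⟩ -
      -- `max d d'` lies in both balls, and ultrametric balls that meet are nested.
      have hx : ∀ x, x = max d d' → x ∈ D := by
        rintro x rfl
        rcases max_choice d d' with h | h <;> rw [h] <;> assumption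
      have hm := hx _ rfl
      have h1 : max d d' ∈ ball d e := mem_ball_of_le (le_max_left _ _) (h.lt _ hm _ he).le
      have h2 : max d d' ∈ ball d' e' := mem_ball_of_le (le_max_right _ _) (h.lt _ hm _ he').le
      rcases le_total (v (d - e)) (v (d' - e')) with hv | hv
      · exact Or.inr (ball_subset_ball h2 h1 hv)
      · exact Or.inl (ball_subset_ball h1 h2 hv)
  have hcD : ∀ d ∈ D, ∀ e ∈ E, v (e - d) ≤ v (c - d) := fun d hd e he => by
    have : c ∈ ball d e := hc _ ⟨d, hd, e, he, rfl⟩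
    rwa [mem_ball, v_sub_comm, v_sub_comm d c] at this
  have hcE : ∀ d ∈ D, ∀ e ∈ E, v (e - d) ≤ v (e - c) := fun d hd e he => by
    have h1 : e - c = (e - d) - (c - d) := by abel
    rw [h1]
    exact (le_min le_rfl (hcD d hd e he)).trans (min_le_v_sub _ _)
  rcases h.mem_or_mem c with hcm | hcm
  · refine ⟨c, Or.inl ⟨hcm, fun d hd hcd e he => ?_⟩⟩
    -- Some pair is strictly closer than `c` and `e`. Moving `d'` up to `max d d'` keeps it so, and
    -- `c` lies in the resulting ball.
    obtain ⟨d', hd', e', he', hlt⟩ := hmax c hcm e he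
    refine hlt.trans_le ?_
    have hm : max d d' ∈ D := by rcases max_choice d d' with h | h <;> rw [h] <;> assumption
    calc v (e' - d') ≤ v (e' - max d d') := v_sub_antitone_of_cut h hm he' (le_max_right _ _) le_rfl
      _ ≤ v (c - max d d') := hcD _ hm _ he'
      _ = v (max d d' - c) := v_sub_comm _ _
      _ ≤ v (d - c) := v_le_of_le (sub_nonneg.2 hcd) (by gcongr; exact le_max_left _ _)
  · refine ⟨-c, Or.inr ⟨by simpa using hcm, fun x hx hcx y hy => ?_⟩⟩
    obtain ⟨e, rfl⟩ : ∃ e, x = -e := ⟨-x, (neg_neg _).symm⟩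
    obtain ⟨d, rfl⟩ : ∃ d, y = -d := ⟨-y, (neg_neg _).symm⟩
    have he : e ∈ E := by simpa using hx
    have hd : d ∈ D := by simpa using hy
    have hec : e ≤ c := neg_le_neg_iff.1 hcx
    rw [show -d - -c = c - d by abel, show -e - -c = c - e by abel]
    obtain ⟨d', hd', e', he', hlt⟩ := hmax d hd c hcm
    refine hlt.trans_le ?_
    have hm : min e e' ∈ E := by rcases min_choice e e' with h | h <;> rw [h] <;> assumption
    calc v (e' - d') ≤ v (min e e' - d') :=
          v_sub_antitone_of_cut h hd' hm le_rfl (min_le_right _ _)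
      _ ≤ v (min e e' - c) := hcE _ hd' _ hm
      _ = v (c - min e e') := v_sub_comm _ _
      _ ≤ v (c - e) := v_le_of_le (sub_nonneg.2 hec) (by gcongr; exact min_le_left _ _)

theorem exists_center (hS : SphericallyComplete G)
    (hR : ∀ γ : ValueSet G, ∃ φ, IsResidue γ φ ∧ Function.Surjective φ) (h : IsCut D E) :
    ∃ c, IsCenter D E c ∨ IsCenter (Neg.neg ⁻¹' E) (Neg.neg ⁻¹' D) c := by
  by_cases hmax : ∀ d ∈ D, ∀ e ∈ E, ∃ d' ∈ D, ∃ e' ∈ E, v (e - d) < v (e' - d')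
  · exact exists_center_of_noMax hS h hmax
  · push Not at hmax
    obtain ⟨d, hd, e, he, hmax⟩ := hmax
    have hne : v (e - d) ≠ ⊤ := fun h0 => (sub_pos.2 (h.lt d hd e he)).ne' (v_eq_top.1 h0)
    obtain ⟨φ, hφ, hs⟩ := hR ⟨v (e - d), hne⟩
    exact exists_center_of_max h hφ hs hd he rfl hmax

theorem asymmetric_of_cut (hS : SphericallyComplete G)
    (hV : StronglySymmetricallyComplete (ValueSet G))
    (hR : ∀ γ : ValueSet G, ∃ φ, IsResidue γ φ ∧ Function.Surjective φ) (h : IsCut D E) :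
    IsAsymmetric D E ∧ (ℵ₀ < cf (ValueSet G) → IsStronglyAsymmetric D E) := by
  have hG := halving_of_residues hR
  obtain ⟨c, hc | hc⟩ := exists_center hS hR h
  · exact asymmetric_of_isCenter hG hV h hc
  · obtain ⟨h1, h2⟩ := asymmetric_of_isCenter hG hV h.neg hc
    unfold IsStronglyAsymmetric IsAsymmetric at *
    rw [cf_preimage_neg, ci_preimage_neg] at *
    exact ⟨h1.symm, fun hcf => ⟨h1.symm, (h2 hcf).2.symm⟩⟩

end Center

end SymmComplete

namespace SymmComplete

variable {G : Type u} [AddCommGroup G] [LinearOrder G] [IsOrderedAddMonoid G]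

/-! ### Necessity: the components are `ℝ` -/

section Components

variable {γ : ValueSet G} {φ : valO γ →+ ℝ}

/-- If `φ b` is the least positive residue, there is a gap between `ℳ_γ` and `b + ℳ_γ`, and `x ↦ b -
x` exchanges its sides. -/
theorem IsResidue.not_symmetricallyComplete_of_isLeast (hφ : IsResidue γ φ) {a : ℝ}
    (ha : IsLeast {r | r ∈ φ.range ∧ 0 < r} a) : ¬ SymmetricallyComplete G := by
  intro hS
  obtain ⟨⟨⟨b, rfl⟩, hb⟩, hleast⟩ := ha
  have hb0 : (0 : G) < b := hφ.lt_of_lt (a := 0) (b := b) (by rwa [map_zero])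
  have hvb : v (b : G) = γ.1 := hφ.v_eq_iff.2 hb.ne'
  have hcut : IsCut {x : G | ∃ m, γ.1 < v m ∧ x ≤ m} {x : G | ∃ m, γ.1 < v m ∧ b + m ≤ x} := by
    have h0 : γ.1 < v (0 : G) := (valM γ).zero_mem
    refine ⟨⟨0, 0, h0, le_rfl⟩, ⟨b, 0, h0, by simp⟩, ?_, ?_⟩
    · refine Set.eq_univ_of_forall fun x => ?_
      rcases le_or_gt x 0 with hx | hx
      · exact Or.inl ⟨0, h0, hx⟩
      rcases le_or_gt (b : G) x with hxb | hxb
      · exact Or.inr ⟨0, h0, by simpa using hxb⟩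
      set y : valO γ := ⟨x, hvb.ge.trans (v_le_of_le hx.le hxb.le)⟩ with hy
      rcases le_or_gt (φ y) 0 with h | h
      · have h' : φ 0 ≤ φ y := hφ.mono hx.le
        rw [map_zero] at h'
        exact Or.inl ⟨x, (hφ.eq_zero_iff y).1 (le_antisymm h h'), le_rfl⟩
      · have h1 : φ b ≤ φ y := hleast ⟨⟨y, rfl⟩, h⟩
        have h2 : φ y ≤ φ b := hφ.mono hxb.le
        have h3 : φ (y - b) = 0 := by rw [map_sub, sub_eq_zero]; exact le_antisymm h2 h1
        exact Or.inr ⟨x - b, (hφ.eq_zero_iff _).1 h3, by simp⟩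
    · rintro x ⟨m, hm, hxm⟩ y ⟨m', hm', hmy⟩
      have h1 : m - m' ∈ valM γ := sub_mem hm hm'
      have h2 : m - m' < b := lt_of_v_lt hb0.le (hvb.trans_lt h1)
      exact hxm.trans_lt ((sub_lt_iff_lt_add.1 h2).trans_le hmy)
  refine hS _ _ hcut (cf_eq_ci_of_strictAntiOn (fun x => b - x) ?_ ?_ ?_)
  · intro x _ y _ h
    exact sub_lt_sub_left h _
  · rintro x ⟨m, hm, hxm⟩
    refine ⟨-m, by rwa [v_neg], ?_⟩
    rw [← sub_eq_add_neg]
    exact sub_le_sub_left hxm _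
  · rintro y ⟨m, hm, hmy⟩
    exact ⟨-m, ⟨-m, by rwa [v_neg], le_rfl⟩, by rwa [sub_neg_eq_add]⟩

theorem IsResidue.cf_lower (hφ : IsResidue γ φ) (hd : Dense (φ.range : Set ℝ)) (r : ℝ) :
    cf {x : G | ∃ y : valO γ, φ y < r ∧ x ≤ y} = ℵ₀ := by
  have hbtw : ∀ s < r, ∃ y : valO γ, s < φ y ∧ φ y < r := fun s hs => by
    obtain ⟨_, ⟨y, rfl⟩, h⟩ := hd.exists_between hs
    exact ⟨y, h⟩
  choose z hz hzr using fun n : ℕ => hbtw (r - 1 / ((n : ℝ) + 1)) (by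
    have : (0 : ℝ) < 1 / ((n : ℝ) + 1) := by positivity
    linarith)
  refine cf_eq_aleph0 ⟨z 0, z 0, hzr 0, le_rfl⟩ ?_ (fun n => z n) (fun n => ⟨z n, hzr n, le_rfl⟩) ?_
  · rintro x ⟨y, hy, hxy⟩
    obtain ⟨y', h1, h2⟩ := hbtw _ hy
    exact ⟨y', ⟨y', h2, le_rfl⟩, hxy.trans_lt (hφ.lt_of_lt h1)⟩
  · rintro x ⟨y, hy, hxy⟩
    obtain ⟨n, hn⟩ := exists_nat_one_div_lt (sub_pos.2 hy)
    refine ⟨n, hxy.trans (hφ.lt_of_lt (a := y) (b := z n) ?_).le⟩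
    have := hz n
    linarith

/-- The omitted real `r` cuts `G` into two sides, each approached by a sequence of residues tending
to `r`. -/
theorem IsResidue.not_symmetricallyComplete_of_dense (hφ : IsResidue γ φ)
    (hd : Dense (φ.range : Set ℝ)) {r : ℝ} (hr : r ∉ φ.range) : ¬ SymmetricallyComplete G := by
  intro hS
  have hupper : {x : G | ∃ y : valO γ, r < φ y ∧ y ≤ x} =
      Neg.neg ⁻¹' {x : G | ∃ y : valO γ, φ y < -r ∧ x ≤ y} := by
    ext x
    constructor
    · rintro ⟨y, hy, hyx⟩
      exact ⟨-y, by rw [map_neg]; linarith, neg_le_neg hyx⟩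
    · rintro ⟨y, hy, hyx⟩
      exact ⟨-y, by rw [map_neg]; linarith, neg_le.1 hyx⟩
  obtain ⟨_, ⟨y₀, rfl⟩, -, hy₀⟩ := hd.exists_between (sub_one_lt r)
  obtain ⟨_, ⟨y₁, rfl⟩, hy₁, -⟩ := hd.exists_between (lt_add_one r)
  have hcut : IsCut {x : G | ∃ y : valO γ, φ y < r ∧ x ≤ y}
      {x : G | ∃ y : valO γ, r < φ y ∧ y ≤ x} := by
    refine ⟨⟨y₀, y₀, hy₀, le_rfl⟩, ⟨y₁, y₁, hy₁, le_rfl⟩, ?_, ?_⟩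
    · refine Set.eq_univ_of_forall fun x => ?_
      rcases le_or_gt x y₀ with h0 | h0
      · exact Or.inl ⟨y₀, hy₀, h0⟩
      rcases le_or_gt (y₁ : G) x with h1 | h1
      · exact Or.inr ⟨y₁, hy₁, h1⟩
      set y : valO γ := ⟨x, (le_min y₀.2 y₁.2).trans
        (ArchimedeanClass.min_le_mk_of_le_of_le h0.le h1.le)⟩
      rcases lt_trichotomy (φ y) r with h | h | h
      · exact Or.inl ⟨y, h, le_rfl⟩
      · exact absurd ⟨y, h⟩ hr
      · exact Or.inr ⟨y, h, le_rfl⟩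
    · rintro x ⟨y, hy, hxy⟩ x' ⟨y', hy', hxy'⟩
      have hyy : (y : G) < y' := hφ.lt_of_lt (hy.trans hy')
      exact hxy.trans_lt (hyy.trans_le hxy')
  refine hS _ _ hcut ?_
  rw [hupper, ci_preimage_neg, hφ.cf_lower hd, hφ.cf_lower hd]

/-- A nontrivial subgroup of `ℝ` has a least positive element or is dense; the range is nontrivial
because `γ` is the value of a nonzero element. -/
theorem IsResidue.surjective (hS : SymmetricallyComplete G) (hφ : IsResidue γ φ) :
    Function.Surjective φ := by
  by_contra hns
  obtain ⟨r, hr⟩ := not_forall.1 hns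
  refine hφ.not_symmetricallyComplete_of_dense ?_ (r := r) hr hS
  refine AddSubgroup.dense_of_no_min _ ?_ fun ⟨a, ha⟩ =>
    hφ.not_symmetricallyComplete_of_isLeast ha hS
  obtain ⟨g, hg, hv⟩ := exists_pos_v_eq γ
  intro hbot
  have hmem : φ ⟨g, hv.ge⟩ ∈ φ.range := ⟨_, rfl⟩
  rw [hbot, AddSubgroup.mem_bot] at hmem
  exact (hφ.pos (a := ⟨g, hv.ge⟩) hg hv).ne' hmem

theorem SymmetricallyComplete.component_iso (hS : SymmetricallyComplete G) (γ : ValueSet G) :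
    Nonempty (Component γ ≃+o ℝ) :=
  component_iso_of_surjective fun _ hφ => hφ.surjective hS

end Components

/-! ### Necessity: the value set -/

theorem SymmetricallyComplete.valueSet (hG : Halving G) (hS : SymmetricallyComplete G) :
    StronglySymmetricallyComplete (ValueSet G) := by
  intro Δ Λ h
  -- The order reversal puts the lower half `Δ` on the upper side.
  have hcut : IsCut {x : G | ∃ y ∈ posIn Λ, x ≤ y} (posIn Δ) := by
    obtain ⟨δ, hδ⟩ := h.nonempty_lower
    obtain ⟨ε, hε⟩ := h.nonempty_upper
    obtain ⟨x, hx, -⟩ := exists_mem_posIn hδ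
    obtain ⟨y, hy, -⟩ := exists_mem_posIn hε
    refine ⟨⟨y, y, hy, le_rfl⟩, ⟨x, hx⟩, Set.eq_univ_of_forall fun z => ?_, ?_⟩
    · rcases le_or_gt z 0 with hz | hz
      · exact Or.inl ⟨y, hy, hz.trans hy.1.le⟩
      · rcases h.mem_or_mem ⟨v z, fun h0 => hz.ne' (v_eq_top.1 h0)⟩ with hm | hm
        · exact Or.inr ⟨hz, _, hm, rfl⟩
        · exact Or.inl ⟨z, ⟨hz, _, hm, rfl⟩, le_rfl⟩
    · rintro z ⟨y, ⟨-, ε, hε, hyε⟩, hzy⟩ x ⟨hx, δ, hδ, hxδ⟩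
      refine hzy.trans_lt (lt_of_v_lt hx.le ?_)
      rw [hyε, hxδ]
      exact h.lt δ hδ ε hε
  have hD : cf {x : G | ∃ y ∈ posIn Λ, x ≤ y} = max (ci Λ) ℵ₀ := by
    rw [← cf_posIn h.nonempty_upper]
    exact (cf_eq_cf_of_strictMonoOn (s := posIn Λ) (t := {x : G | ∃ y ∈ posIn Λ, x ≤ y}) id (fun _ _ _ _ h => h)
      (fun x hx => ⟨x, hx, le_rfl⟩) fun y hy => hy).symm
  have := hS _ _ hcut
  rw [IsAsymmetric, hD, ci_posIn hG h.nonempty_lower] at this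
  exact stronglyAsymmetric_iff_max.2 this.symm

/-! ### Necessity: spherical completeness -/

section Spherical

theorem left_mem_ball (a b : G) : a ∈ ball a b := by
  rw [mem_ball, sub_self]
  exact le_top

theorem ordConnected_ball (a b : G) : (ball a b).OrdConnected where
  out' _ hx _ hz _ hy := mem_ball.2 <| (le_min hz hx).trans
    (ArchimedeanClass.min_le_mk_of_le_of_le (sub_le_sub_left hy.2 a) (sub_le_sub_left hy.1 a))

/-- For `w` in the larger ball only, `|a' - w|` exceeds all distances from `a'` inside the smaller
one, so `a' ± |a' - w|` bracket it. -/
theorem exists_mem_ball_of_ssubset {a b a' b' : G} (h : ball a' b' ⊂ ball a b) :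
    ∃ l ∈ ball a b, ∃ u ∈ ball a b, ∀ x ∈ ball a' b', l < x ∧ x < u := by
  obtain ⟨w, hw, hw'⟩ := Set.exists_of_ssubset h
  have ha' : a' ∈ ball a b := h.1 (left_mem_ball a' b')
  have hv : v |a' - w| = v (a' - w) := ArchimedeanClass.mk_abs _
  rw [mem_ball, not_le, ← hv] at hw'
  have hle : v (a - b) ≤ v |a' - w| := by
    rw [hv, show a' - w = (a - w) - (a - a') by abel]
    exact (le_min hw ha').trans (min_le_v_sub _ _)
  refine ⟨a' - |a' - w|, ?_, a' + |a' - w|, ?_, fun x hx => ⟨?_, ?_⟩⟩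
  · rw [mem_ball, show a - (a' - |a' - w|) = (a - a') + |a' - w| by abel]
    exact (le_min ha' hle).trans (min_le_v_add _ _)
  · rw [mem_ball, ← sub_sub]
    exact (le_min ha' hle).trans (min_le_v_sub _ _)
  · exact sub_lt_comm.1 (lt_of_v_lt (abs_nonneg _) (hw'.trans_le hx))
  · rw [mem_ball, v_sub_comm a' x] at hx
    exact sub_lt_iff_lt_add'.1 (lt_of_v_lt (abs_nonneg _) (hw'.trans_le hx))

/-- A chain without a common point determines a cut: each point lies below or above some ball. Both
sides can be approached by bracketing points chosen in the balls. -/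
theorem SymmetricallyComplete.sphericallyComplete (hS : SymmetricallyComplete G) :
    SphericallyComplete G := by
  intro S hne hball hchain
  by_contra hempty
  rw [Set.not_nonempty_iff_eq_empty] at hempty
  have hnot : ∀ x, ∃ B ∈ S, x ∉ B := fun x => by
    have : x ∉ ⋂₀ S := by simp [hempty]
    simpa using this
  have hsub : ∀ B ∈ S, ∀ B' ∈ S, ∀ x ∈ B, x ∉ B' → B' ⊆ B := fun B hB B' hB' x hx hx' =>
    (hchain.total hB hB').resolve_left fun h => hx' (h hx)
  have hnonempty : ∀ B ∈ S, B.Nonempty := fun B hB => by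
    obtain ⟨a, b, rfl⟩ := hball B hB
    exact ⟨a, left_mem_ball a b⟩
  have hlu : ∀ B : S, ∃ l ∈ B.1, ∃ u ∈ B.1, ∃ B' ∈ S, ∀ x ∈ B', l < x ∧ x < u := by
    rintro ⟨B, hB⟩
    obtain ⟨x, hx⟩ := hnonempty B hB
    obtain ⟨B', hB', hx'⟩ := hnot x
    have hss : B' ⊂ B := ⟨hsub B hB B' hB' x hx hx', fun h => hx' (h hx)⟩
    obtain ⟨a, b, rfl⟩ := hball B hB
    obtain ⟨a', b', rfl⟩ := hball B' hB'
    obtain ⟨l, hl, u, hu, h⟩ := exists_mem_ball_of_ssubset hss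
    exact ⟨l, hl, u, hu, _, hB', h⟩
  choose l hl u hu s hs hlus using hlu
  set D : Set G := {x | ∃ B ∈ S, ∀ y ∈ B, x < y}
  set E : Set G := {x | ∃ B ∈ S, ∀ y ∈ B, y < x}
  have hlD : ∀ B, l B ∈ D := fun B => ⟨s B, hs B, fun x hx => (hlus B x hx).1⟩
  have huE : ∀ B, u B ∈ E := fun B => ⟨s B, hs B, fun x hx => (hlus B x hx).2⟩
  have hcut : IsCut D E := by
    obtain ⟨B₀, hB₀⟩ := hne
    refine ⟨⟨_, hlD ⟨B₀, hB₀⟩⟩, ⟨_, huE ⟨B₀, hB₀⟩⟩, Set.eq_univ_of_forall fun x => ?_, ?_⟩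
    · obtain ⟨B, hB, hx⟩ := hnot x
      have hc : B.OrdConnected := by
        obtain ⟨a, b, rfl⟩ := hball B hB
        exact ordConnected_ball a b
      obtain ⟨a, ha⟩ := hnonempty B hB
      rcases lt_or_gt_of_ne (show x ≠ a from fun h => hx (h ▸ ha)) with h | h
      · refine Or.inl ⟨B, hB, fun y hy => ?_⟩
        by_contra! hle
        exact hx (hc.out hy ha ⟨hle, h.le⟩)
      · refine Or.inr ⟨B, hB, fun y hy => ?_⟩
        by_contra! hle
        exact hx (hc.out ha hy ⟨h.le, hle⟩)
    · rintro x ⟨B, hB, hx⟩ y ⟨B', hB', hy⟩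
      rcases hchain.total hB hB' with h | h
      · obtain ⟨a, ha⟩ := hnonempty B hB
        exact (hx a ha).trans (hy a (h ha))
      · obtain ⟨a, ha⟩ := hnonempty B' hB'
        exact (hx a (h ha)).trans (hy a ha)
  choose bD hbD hbDlt using fun x : D => x.2
  choose bE hbE hbElt using fun x : E => x.2
  -- As `y ∈ E` descends, the balls below it shrink, so their left brackets climb past every point
  -- of `D`; symmetrically for the other inequality. No monotone choice of brackets is needed.
  refine hS D E hcut (le_antisymm ?_ ?_)
  · refine cf_le_ci_of_tendsto (s := E) (t := D)
      (fun y => ⟨l ⟨bE y, hbE y⟩, hlD _⟩) fun x => ?_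
    refine ⟨⟨u ⟨bD x, hbD x⟩, huE _⟩, fun y hy => ?_⟩
    have hsb : bE y ⊆ bD x := hsub _ (hbD x) _ (hbE y) _ (hu ⟨bD x, hbD x⟩) fun hm =>
      (hbElt y _ hm).not_ge hy
    exact (hbDlt x _ (hsb (hl ⟨bE y, hbE y⟩))).le
  · refine ci_le_cf_of_tendsto (s := D) (t := E)
      (fun x => ⟨u ⟨bD x, hbD x⟩, huE _⟩) fun y => ?_
    refine ⟨⟨l ⟨bE y, hbE y⟩, hlD _⟩, fun x hx => ?_⟩
    have hsb : bD x ⊆ bE y := hsub _ (hbE y) _ (hbD x) _ (hl ⟨bE y, hbE y⟩) fun hm =>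
      (hbDlt x _ hm).not_ge hx
    exact (hbElt y _ (hsb (hu ⟨bD x, hbD x⟩))).le

end Spherical

/-! ### The three equivalences -/

variable (G) in
/-- Spherical completeness, with strongly symmetrically complete value set and archimedean
components `ℝ`. -/
def ValuationCriterion : Prop :=
  SphericallyComplete G ∧ StronglySymmetricallyComplete (ValueSet G) ∧
    ∀ γ : ValueSet G, Nonempty (Component γ ≃+o ℝ)

theorem ValuationCriterion.halving (h : ValuationCriterion G) : Halving G :=
  halving_of_residues fun γ => exists_surjective_residue (h.2.2 γ)

theorem ValuationCriterion.asymmetric (h : ValuationCriterion G) {D E : Set G}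
    (hc : IsCut D E) : IsAsymmetric D E ∧ (ℵ₀ < cf (ValueSet G) → IsStronglyAsymmetric D E) :=
  asymmetric_of_cut h.1 h.2.1 (fun γ => exists_surjective_residue (h.2.2 γ)) hc

theorem symmetricallyComplete_iff : SymmetricallyComplete G ↔ ValuationCriterion G := by
  refine ⟨fun h => ?_, fun h D E hc => (h.asymmetric hc).1⟩
  have hR := h.component_iso
  exact ⟨h.sphericallyComplete,
    h.valueSet (halving_of_residues fun γ => exists_surjective_residue (hR γ)), hR⟩

theorem posIn_univ : posIn (Set.univ : Set (ValueSet G)) = Set.Ioi 0 := by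
  ext x
  exact ⟨fun h => h.1, fun h => ⟨h, ⟨v x, fun h0 => (ne_of_gt h) (v_eq_top.1 h0)⟩, trivial, rfl⟩⟩

theorem StronglySymmetricallyComplete.symmetricallyComplete {I : Type u} [LinearOrder I]
    (h : StronglySymmetricallyComplete I) : SymmetricallyComplete I :=
  fun D E hc => (h D E hc).1

/-- The cut just above `0` has cofinality `(1, max (cf vG) ℵ₀)`. -/
theorem aleph0_lt_cf_valueSet [Nontrivial G] (hG : Halving G)
    (h : StronglySymmetricallyComplete G) : ℵ₀ < cf (ValueSet G) := by
  have hcut : IsCut (Set.Iic (0 : G)) (Set.Ioi 0) :=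
    ⟨⟨0, le_rfl⟩, exists_gt 0, Set.Iic_union_Ioi, fun _ hd _ he => lt_of_le_of_lt hd he⟩
  have h1 := (h _ _ hcut).2
  rw [cf_eq_one (Set.self_mem_Iic) fun _ hx => hx, ← posIn_univ, ci_posIn hG Set.univ_nonempty]
    at h1
  simp only [one_lt_aleph0.not_gt, lt_max_iff, lt_irrefl, or_false, false_or] at h1
  exact h1.trans_eq OrderIso.Set.univ.cof_congr

theorem stronglySymmetricallyComplete_iff [Nontrivial G] :
    StronglySymmetricallyComplete G ↔ ValuationCriterion G ∧ ℵ₀ < cf (ValueSet G) := by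
  refine ⟨fun h => ?_, fun h D E hc => (h.1.asymmetric hc).2 h.2⟩
  have hG := symmetricallyComplete_iff.1 h.symmetricallyComplete
  exact ⟨hG, aleph0_lt_cf_valueSet hG.halving h⟩

theorem ci_eq_cf : ci G = cf G := (OrderIso.neg G).cof_congr.symm

theorem cf_eq_max_ci_valueSet [Nontrivial G] : cf G = max (ci (ValueSet G)) ℵ₀ := by
  have h1 : cf (Set.Ioi (0 : G)) = cf G := by
    refine Order.cof_eq_of_isCofinal fun x => ?_
    obtain ⟨y, hy⟩ := exists_gt (max x 0)
    exact ⟨y, (le_max_right _ _).trans_lt hy, (le_max_left _ _).trans hy.le⟩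
  rw [← h1, ← posIn_univ, cf_posIn Set.univ_nonempty]
  congr 1
  exact OrderIso.Set.univ.dual.cof_congr

theorem extremelySymmetricallyComplete_iff :
    ExtremelySymmetricallyComplete G ↔
      ValuationCriterion G ∧ ExtremelySymmetricallyComplete (ValueSet G) := by
  -- For trivial `G` both sides fail: `G` and its empty value set have countable cofinality.
  cases subsingleton_or_nontrivial G
  · have h1 : ¬ ℵ₀ < cf G := fun h => h.not_ge ((Order.cof_le_cardinalMk G).trans mk_le_aleph0)
    have h2 : ¬ ℵ₀ < cf (ValueSet G) := fun h => by
      have : IsEmpty (ValueSet G) := ⟨fun γ => by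
        obtain ⟨g, hg, -⟩ := exists_pos_v_eq γ
        exact hg.ne (Subsingleton.elim _ _)⟩
      exact h.not_ge ((Order.cof_le_cardinalMk _).trans mk_le_aleph0)
    exact iff_of_false (fun h => h1 h.2.2) fun h => h2 h.2.2.2
  · rw [ExtremelySymmetricallyComplete, ExtremelySymmetricallyComplete, ci_eq_cf,
      cf_eq_max_ci_valueSet, stronglySymmetricallyComplete_iff]
    simp only [lt_max_iff, lt_irrefl, or_false, and_self]
    exact ⟨fun ⟨⟨h, hc⟩, hi⟩ => ⟨h, h.2.1, hi, hc⟩, fun ⟨h, _, hi, hc⟩ => ⟨⟨h, hc⟩, hi⟩⟩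

end SymmComplete

open SymmComplete in
theorem theorem1p3 (G : Type u) [AddCommGroup G] [LinearOrder G] [IsOrderedAddMonoid G] :
    (SymmetricallyComplete G ↔
      SphericallyComplete G ∧ StronglySymmetricallyComplete (ValueSet G) ∧
        ∀ γ : ValueSet G, Nonempty (Component γ ≃+o ℝ)) ∧
    (Nontrivial G →
      (StronglySymmetricallyComplete G ↔
        (SphericallyComplete G ∧ StronglySymmetricallyComplete (ValueSet G) ∧
          ∀ γ : ValueSet G, Nonempty (Component γ ≃+o ℝ)) ∧ ℵ₀ < cf (ValueSet G))) ∧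
    (ExtremelySymmetricallyComplete G ↔
      (SphericallyComplete G ∧ StronglySymmetricallyComplete (ValueSet G) ∧
        ∀ γ : ValueSet G, Nonempty (Component γ ≃+o ℝ)) ∧
          ExtremelySymmetricallyComplete (ValueSet G)) :=
  ⟨symmetricallyComplete_iff, fun _ => stronglySymmetricallyComplete_iff,
    extremelySymmetricallyComplete_iff⟩
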